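/- Let $I=[0,1]$ and let $C(I)$ be the space of continuous maps $f:I\to I$ with the supremum metric. For $f\in C(I)$ let $h_{\mathrm{top}}(f)\in[0,+\infty]$ be its topological entropy, and for $a\in[0,+\infty]$ let $$E_{\le a}=\{f\in C(I):h_{\mathrm{top}}(f)\le a\},\qquad E_{<a}=\{f\in C(I):h_{\mathrm{top}}(f)<a\},$$ with the subspace topology. A map $f\in C(I)$ is piecewise monotone if there are $0=t_0<t_1<\cdots<t_n=1$ such that $f|_{[t_{i-1},t_i]}$ is monotone (nondecreasing or nonincreasing) for $i=1,\dots,n$; let $E^{PM}_{\le a}$ and $E^{PM}_{<a}$ be the sets of piecewise monotone maps in $E_{\le a}$ and $E_{<a}$. A subset $A$ of a space $X$ is homotopy dense in $X$ if there is a continuous map $H:X\times[0,1]\to X$ with $H(x,0)=x$ for all $x\in X$ and $H(x,t)\in A$ for all $x\in X$ and $t\in(0,1]$. Then, for every $a\in[0,+\infty]$: (1) $E_{\le a}$ is contractible, and $E_{<a}$ is contractible if $a>0$ (the space $E_{<0}$ is empty); (2) $E^{PM}_{\le a}$ is homotopy dense in $E_{\le a}$, and $E^{PM}_{<a}$ is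 homotopy dense in $E_{<a}$. -/

import Mathlib

open scoped unitInterval ENNReal

namespace IntervalMaps

/-- The topological entropy of a continuous self-map of `[0,1]`, as an extended real number
(it is nonnegative, and may be `⊤`). The entropy is Mathlib's, defined by the exponential growth
rate of the minimal number of dynamical balls needed to cover the whole space. -/
noncomputable def topEntropy (f : C(I, I)) : EReal :=
  Dynamics.coverEntropy f Set.univ

/-- The continuous self-maps of `[0,1]` with topological entropy at most `a`. The topology on
`C(I, I)` is that of the supremum metric. -/
def entropyLE (a : ℝ≥0∞) : Set C(I, I) :=
  {f | topEntropy f ≤ (a : EReal)}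

/-- The continuous self-maps of `[0,1]` with topological entropy less than `a`. -/
def entropyLT (a : ℝ≥0∞) : Set C(I, I) :=
  {f | topEntropy f < (a : EReal)}

/-- `f` is piecewise monotone: there are `0 = t 0 < t 1 < ⋯ < t n = 1` such that `f` is monotone
(nondecreasing or nonincreasing) on each `[t i, t (i + 1)]`. -/
def IsPiecewiseMonotone (f : C(I, I)) : Prop :=
  ∃ (n : ℕ) (t : Fin (n + 1) → I), StrictMono t ∧ t 0 = 0 ∧ t (Fin.last n) = 1 ∧
    ∀ i : Fin n, MonotoneOn f (Set.Icc (t i.castSucc) (t i.succ)) ∨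
      AntitoneOn f (Set.Icc (t i.castSucc) (t i.succ))

/-- The piecewise monotone maps with topological entropy at most `a`. -/
def entropyLEPM (a : ℝ≥0∞) : Set C(I, I) :=
  entropyLE a ∩ {f | IsPiecewiseMonotone f}

/-- The piecewise monotone maps with topological entropy less than `a`. -/
def entropyLTPM (a : ℝ≥0∞) : Set C(I, I) :=
  entropyLT a ∩ {f | IsPiecewiseMonotone f}

/-- `A` is homotopy dense in the space `X`: some homotopy `H : X × [0,1] → X` starts at the
identity and satisfies `H (x, t) ∈ A` for all `x` and all `t ∈ (0,1]`. -/
def IsHomotopyDense {X : Type*} [TopologicalSpace X] (A : Set X) : Prop :=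
  ∃ H : C(X × I, X), (∀ x, H (x, 0) = x) ∧ ∀ x, ∀ t : I, 0 < t → H (x, t) ∈ A

end IntervalMaps

/-! Call `g` a flattening of `f` when each interval has a `g`-image that lies inside its `f`-image
or is at most a point. Everything follows from one fact, `IsFlattening.coverEntropy_le`: flattening
does not raise entropy. Both homotopies then move maps only through their flattenings, so they stay
in the sublevel sets: lowering a truncation level `c` in `f ⊓ c` contracts to the constant 0, and
cutting peaks at depth `t` (`trimMap`) gives piecewise monotone maps for `t > 0`.

For the entropy bound, code orbits by a partition into half-open intervals. The points reached by
`g` along a given itinerary form an interval, which lies in the corresponding set for `f` until it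
collapses to a point. From the collapse on, the future is that of a single point, so `g` has at most
`n + 1` times as many itineraries of length `n` as `f`. Comparing itineraries with dynamical covers
costs a factor `3 ^ n`, whence `h(g) ≤ log 6 + h(f)`. Since `g^[N]` is a flattening of `f^[N]`, the
additive constant disappears on dividing by `N`. -/

namespace IntervalMaps

open Set Function

/-! ### Flattenings and counting itineraries -/

/-- `g` is a flattening of `f` if the image of every interval under `g` is either contained in its
image under `f` or has at most one point. -/
def IsFlattening (g f : I → I) : Prop :=
  ∀ J : Set I, J.OrdConnected → g '' J ⊆ f '' J ∨ (g '' J).Subsingleton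

lemma ordConnected_image {g : I → I} (hg : Continuous g) {J : Set I} (hJ : J.OrdConnected) :
    (g '' J).OrdConnected :=
  (hJ.isPreconnected.image g hg.continuousOn).ordConnected

/-- A point image stays a point; otherwise `g^[n] '' J` is again an interval, to which the
flattening property applies. -/
lemma IsFlattening.iterate {g f : I → I} (h : IsFlattening g f) (hg : Continuous g) (n : ℕ) :
    IsFlattening g^[n] f^[n] := by
  induction n with
  | zero => exact fun J _ => Or.inl (by simp)
  | succ n ih =>
    intro J hJ
    rw [iterate_succ', iterate_succ', image_comp, image_comp]
    rcases ih J hJ with h1 | h1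
    · rcases h _ (ordConnected_image (hg.iterate n) hJ) with h2 | h2
      · exact Or.inl (h2.trans (image_mono h1))
      · exact Or.inr h2
    · exact Or.inr (h1.image g)

/-- The itinerary of `x` under `T` for the first `n` times, with respect to the labelling `q`. -/
def itinerary (T : I → I) (q : I → ℕ) (n : ℕ) (x : I) : ℕ → ℕ :=
  fun i => if i < n then q (T^[i] x) else 0

lemma itinerary_eq_iff {T S : I → I} {q : I → ℕ} {n : ℕ} {x y : I} :
    itinerary T q n x = itinerary S q n y ↔ ∀ i < n, q (T^[i] x) = q (S^[i] y) := by
  refine ⟨fun h i hi => by simpa [itinerary, hi] using congrFun h i, fun h => funext fun i => ?_⟩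
  by_cases hi : i < n
  · simpa [itinerary, hi] using h i hi
  · simp [itinerary, hi]

/-- The positions at time `n` of the points whose first `n` labels are those of `u`. -/
def reach (T : I → I) (q : I → ℕ) (u : ℕ → ℕ) (n : ℕ) : Set I :=
  {z | ∃ x, (∀ i < n, q (T^[i] x) = u i) ∧ T^[n] x = z}

lemma reach_zero (T : I → I) (q : I → ℕ) (u : ℕ → ℕ) : reach T q u 0 = univ := by
  ext z; simp [reach]

lemma reach_succ (T : I → I) (q : I → ℕ) (u : ℕ → ℕ) (n : ℕ) :
    reach T q u (n + 1) = T '' (reach T q u n ∩ q ⁻¹' {u n}) := by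
  ext z
  constructor
  · rintro ⟨x, hx, rfl⟩
    exact ⟨T^[n] x, ⟨⟨x, fun i hi => hx i (by omega), rfl⟩, hx n (by omega)⟩,
      (iterate_succ_apply' T n x).symm⟩
  · rintro ⟨_, ⟨⟨x, hx, rfl⟩, hn⟩, rfl⟩
    refine ⟨x, fun i hi => ?_, iterate_succ_apply' T n x⟩
    rcases Nat.lt_succ_iff_lt_or_eq.mp hi with h | rfl
    · exact hx i h
    · exact hn

lemma ordConnected_reach {T : I → I} (hT : Continuous T) {q : I → ℕ} (hq : Monotone q)
    (u : ℕ → ℕ) (n : ℕ) : (reach T q u n).OrdConnected := by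
  induction n with
  | zero => rw [reach_zero]; exact ordConnected_univ
  | succ n ih =>
    rw [reach_succ]
    exact ordConnected_image hT (ih.inter (ordConnected_singleton.preimage_mono hq))

/-- Monotone labels have order-connected fibres, so each restricted reach set is an interval and
flattening applies one step at a time. -/
lemma IsFlattening.reach_subset {g f : I → I} (h : IsFlattening g f) (hg : Continuous g)
    {q : I → ℕ} (hq : Monotone q) (u : ℕ → ℕ) (n : ℕ) :
    reach g q u n ∩ q ⁻¹' {u n} ⊆ reach f q u n ∩ q ⁻¹' {u n} ∨
      (reach g q u n ∩ q ⁻¹' {u n}).Subsingleton := by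
  induction n with
  | zero => exact Or.inl (by simp [reach_zero])
  | succ n ih =>
    rw [reach_succ, reach_succ]
    rcases ih with h1 | h1
    · rcases h _ ((ordConnected_reach hg hq u n).inter
        (ordConnected_singleton.preimage_mono hq)) with h2 | h2
      · exact Or.inl (inter_subset_inter_left _ (h2.trans (image_mono h1)))
      · exact Or.inr (h2.anti inter_subset_left)
    · exact Or.inr ((h1.image g).anti inter_subset_left)

/-- Every `g`-itinerary of length `n` is an `f`-itinerary, or consists of an `f`-itinerary of
length `i < n` that is continued by the itinerary of one point depending only on it. -/
lemma IsFlattening.exists_itinerary {g f : I → I} (h : IsFlattening g f) (hg : Continuous g)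
    {q : I → ℕ} (hq : Monotone q) (hq' : ∀ z z', z < z' → ∃ s, z < s ∧ s ≤ z' ∧ q s = q z)
    (n : ℕ) (x : I) : ∃ i ≤ n, ∃ y, itinerary g q i x = itinerary f q i y ∧
      (i < n → g^[i] x = sSup (reach g q (itinerary f q i y) i)) := by
  set u : ℕ → ℕ := fun j => q (g^[j] x) with hu
  have hmem : ∀ j, g^[j] x ∈ reach g q u j ∩ q ⁻¹' {u j} :=
    fun j => ⟨⟨x, fun i _ => rfl, rfl⟩, rfl⟩
  have hreal : ∀ i, (∀ j < i, ¬ (reach g q u j ∩ q ⁻¹' {u j}).Subsingleton) →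
      ∃ y, itinerary g q i x = itinerary f q i y := by
    intro i hi
    rcases i with _ | i
    · exact ⟨x, by simp [itinerary_eq_iff]⟩
    · have h1 := (h.reach_subset hg hq u i).resolve_right (hi i (by omega))
      obtain ⟨⟨y, hy, hy2⟩, hy3⟩ := h1 (hmem i)
      refine ⟨y, itinerary_eq_iff.2 fun j hj => ?_⟩
      rcases Nat.lt_succ_iff_lt_or_eq.mp hj with hj | rfl
      · exact (hy j hj).symm
      · rw [hy2]
  by_cases hall : ∀ j < n, ¬ (reach g q u j ∩ q ⁻¹' {u j}).Subsingleton
  · obtain ⟨y, hy⟩ := hreal n hall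
    exact ⟨n, le_rfl, y, hy, fun h => absurd h (lt_irrefl n)⟩
  · push Not at hall
    classical
    have hex : ∃ j, j < n ∧ (reach g q u j ∩ q ⁻¹' {u j}).Subsingleton := hall
    -- At the first collapse time `i`, the labels before `i` are still realised by an `f`-orbit.
    set i := Nat.find hex with hi
    obtain ⟨hin, hsub⟩ := Nat.find_spec hex
    rw [← hi] at hin hsub
    obtain ⟨y, hy⟩ := hreal i fun j hj hs => Nat.find_min hex hj ⟨hj.trans hin, hs⟩
    refine ⟨i, hin.le, y, hy, fun _ => ?_⟩
    have hreach : reach g q (itinerary f q i y) i = reach g q u i := by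
      rw [← hy]
      ext z
      refine exists_congr fun w => and_congr_left fun _ => forall₂_congr fun j hj => ?_
      simp [itinerary, hj, hu]
    rw [hreach]
    -- The collapsed point is the maximum of the reach set: a larger reached point would, by
    -- right-constancy of `q`, give a second reached point in the same cell. Hence it depends only
    -- on the labels before `i`, not on label `i`.
    refine (IsGreatest.csSup_eq ⟨(hmem i).1, fun z hz => ?_⟩).symm
    by_contra hlt
    push Not at hlt
    obtain ⟨s, hs1, hs2, hs3⟩ := hq' _ _ hlt
    have hs : s ∈ reach g q u i :=
      (ordConnected_reach hg hq u i).out (hmem i).1 hz ⟨hs1.le, hs2⟩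
    exact hs1.ne (hsub (hmem i) ⟨hs, hs3⟩)

lemma ncard_range_itinerary_mono {f : I → I} {q : I → ℕ} {i n : ℕ} (hin : i ≤ n)
    (hfin : (range (itinerary f q n)).Finite) :
    (range (itinerary f q i)).Finite ∧
      (range (itinerary f q i)).ncard ≤ (range (itinerary f q n)).ncard := by
  have hsub : range (itinerary f q i) ⊆
      (fun (u : ℕ → ℕ) j => if j < i then u j else 0) '' range (itinerary f q n) := by
    rintro _ ⟨x, rfl⟩
    refine ⟨_, ⟨x, rfl⟩, funext fun j => ?_⟩
    by_cases hj : j < i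
    · simp [itinerary, hj, hj.trans_le hin]
    · simp [itinerary, hj]
  exact ⟨(hfin.image _).subset hsub,
    (ncard_le_ncard hsub (hfin.image _)).trans (ncard_image_le hfin)⟩

lemma IsFlattening.ncard_range_itinerary_le {g f : I → I} (h : IsFlattening g f)
    (hg : Continuous g) {q : I → ℕ} (hq : Monotone q)
    (hq' : ∀ z z', z < z' → ∃ s, z < s ∧ s ≤ z' ∧ q s = q z)
    {n : ℕ} (hfin : (range (itinerary f q n)).Finite) :
    (range (itinerary g q n)).Finite ∧
      (range (itinerary g q n)).ncard ≤ (n + 1) * (range (itinerary f q n)).ncard := by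
  -- `Φ i` rebuilds a `g`-itinerary that collapses at time `i` from its first `i` labels; `i = n`
  -- means no collapse.
  set Φ : ℕ → (ℕ → ℕ) → (ℕ → ℕ) := fun i u j =>
    if j < i then u j else if j < n then q (g^[j - i] (sSup (reach g q u i))) else 0 with hΦ
  have hsub : range (itinerary g q n) ⊆
      ⋃ i ∈ Finset.range (n + 1), Φ i '' range (itinerary f q i) := by
    rintro _ ⟨x, rfl⟩
    obtain ⟨i, hin, y, hy, hx⟩ := h.exists_itinerary hg hq hq' n x
    refine mem_iUnion₂.2 ⟨i, Finset.mem_range.2 (by omega), _, ⟨y, rfl⟩, funext fun j => ?_⟩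
    by_cases hji : j < i
    · have := congrFun hy j
      simp only [hΦ, hji, if_true, ← this]
      simp [itinerary, hji, hji.trans_le hin]
    · by_cases hjn : j < n
      · simp only [hΦ, hji, hjn, if_true, if_false, itinerary]
        rw [← hx (by omega), ← iterate_add_apply, Nat.sub_add_cancel (by omega)]
      · simp [hΦ, hji, hjn, itinerary]
  have hfin' : ∀ i ∈ Finset.range (n + 1), (Φ i '' range (itinerary f q i)).Finite :=
    fun i hi => (ncard_range_itinerary_mono (by simpa [Nat.lt_succ_iff] using hi) hfin).1.image _
  have hU := (Finset.range (n + 1)).finite_toSet.biUnion hfin'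
  refine ⟨hU.subset hsub, (ncard_le_ncard hsub hU).trans ?_⟩
  refine (Finset.set_ncard_biUnion_le _ _).trans ?_
  refine (Finset.sum_le_card_nsmul _ _ (range (itinerary f q n)).ncard fun i hi => ?_).trans
    (by simp)
  have := ncard_range_itinerary_mono (f := f) (q := q)
    (by simpa [Nat.lt_succ_iff] using hi : i ≤ n) hfin
  exact (ncard_image_le this.1).trans this.2

end IntervalMaps

/-! ### From itineraries to covering numbers -/

namespace IntervalMaps

open Set Function Dynamics Uniformity ExpGrowth Filter

lemma coverMincard_le_ncard_range_itinerary {g : I → I} {q : I → ℕ} {U : SetRel I I}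
    (hU : ∀ x y, q x = q y → (x, y) ∈ U) {n : ℕ} (hfin : (range (itinerary g q n)).Finite) :
    coverMincard g univ U n ≤ (range (itinerary g q n)).ncard := by
  classical
  have hch : ∀ u : range (itinerary g q n), ∃ x, itinerary g q n x = u := fun u => u.2
  choose r hr using hch
  have : Fintype (range (itinerary g q n)) := hfin.fintype
  have hcov : IsDynCoverOf g univ U n (Finset.univ.image r : Finset I) := by
    intro x _
    refine ⟨r ⟨_, x, rfl⟩, by simp, mem_dynEntourage.2 fun k hk => hU _ _ ?_⟩
    exact (itinerary_eq_iff.1 (hr ⟨_, x, rfl⟩).symm) k hk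
  refine hcov.coverMincard_le_card.trans ?_
  have h1 := Finset.card_image_le (s := Finset.univ) (f := r)
  rw [Finset.card_univ, ← Nat.card_eq_fintype_card] at h1
  exact_mod_cast h1

lemma ncard_range_itinerary_le_coverMincard {f : I → I} {q : I → ℕ} {V : SetRel I I}
    (hV : ∀ x y, (x, y) ∈ V → q x ≤ q y + 1 ∧ q y ≤ q x + 1) {n : ℕ}
    (htop : coverMincard f univ V n < ⊤) :
    (range (itinerary f q n)).Finite ∧
      ((range (itinerary f q n)).ncard : ℕ∞) ≤ 3 ^ n * coverMincard f univ V n := by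
  classical
  obtain ⟨s, hs, hcard⟩ := (coverMincard_finite_iff _ _ _ _).1 htop
  -- An itinerary is coded by a shadowing centre and ternary digits; digits 0, 1, 2 stand for label
  -- shifts -1, 0, 1.
  set F : I × (Fin n → Fin 3) → ℕ → ℕ := fun p i =>
    if h : i < n then q (f^[i] p.1) + p.2 ⟨i, h⟩ - 1 else 0 with hF
  have hsub : range (itinerary f q n) ⊆ ((s ×ˢ Finset.univ).image F : Finset (ℕ → ℕ)) := by
    rintro _ ⟨x, rfl⟩
    obtain ⟨c, hc, hxc⟩ := hs (mem_univ x)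
    have hxc' := mem_dynEntourage.1 hxc
    have hq : ∀ i < n, q (f^[i] x) + 1 - q (f^[i] c) < 3 ∧ q (f^[i] c) ≤ q (f^[i] x) + 1 := by
      intro i hi
      have := hV _ _ (hxc' i hi)
      omega
    rw [Finset.mem_coe, Finset.mem_image]
    refine ⟨(c, fun i => ⟨_, (hq i i.2).1⟩), by simpa using hc, funext fun i => ?_⟩
    by_cases hi : i < n
    · have := hq i hi
      simp only [hF, hi, dif_pos, itinerary, if_true]
      omega
    · simp [hF, hi, itinerary]
  refine ⟨(Finset.finite_toSet _).subset hsub, ?_⟩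
  rw [← hcard]
  have h1 := (ncard_le_ncard hsub (Finset.finite_toSet _))
  rw [ncard_coe_finset] at h1
  have h2 := h1.trans Finset.card_image_le
  rw [Finset.card_product] at h2
  simp only [Finset.card_univ, Fintype.card_pi, Fintype.card_fin, Finset.prod_const] at h2
  rw [mul_comm] at h2
  exact_mod_cast h2

/-- The index of the interval `[k / m, (k + 1) / m)` that contains `x`. -/
noncomputable def gridIndex (m : ℕ) (x : I) : ℕ := ⌊(m : ℝ) * x⌋₊

lemma gridIndex_monotone (m : ℕ) : Monotone (gridIndex m) := fun _ _ h =>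
  Nat.floor_mono (mul_le_mul_of_nonneg_left h (Nat.cast_nonneg m))

lemma gridIndex_locally_const_right {m : ℕ} (hm : 0 < m) (z z' : I) (h : z < z') :
    ∃ s, z < s ∧ s ≤ z' ∧ gridIndex m s = gridIndex m z := by
  have hm' : (0 : ℝ) < m := Nat.cast_pos.2 hm
  have h1 : (m : ℝ) * z < gridIndex m z + 1 := Nat.lt_floor_add_one _
  have h2 : (z : ℝ) < (gridIndex m z + 1) / m := by rwa [lt_div_iff₀' hm']
  obtain ⟨r, hr1, hr2⟩ := exists_between (lt_min h2 (show (z : ℝ) < z' from h))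
  have hr3 := hr2.trans_le (min_le_right _ _)
  have hr4 := hr2.trans_le (min_le_left _ _)
  rw [lt_div_iff₀' hm'] at hr4
  refine ⟨⟨r, z.2.1.trans hr1.le, hr3.le.trans z'.2.2⟩, hr1, hr3.le, le_antisymm ?_ ?_⟩
  · refine Nat.lt_succ_iff.1 ((Nat.floor_lt (mul_nonneg hm'.le (z.2.1.trans hr1.le))).2 ?_)
    exact_mod_cast hr4
  · exact gridIndex_monotone m (show z ≤ ⟨r, _⟩ from hr1.le)

lemma dist_lt_of_gridIndex_eq {m : ℕ} (hm : 0 < m) {x y : I}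
    (h : gridIndex m x = gridIndex m y) : dist x y < 1 / m := by
  have hm' : (0 : ℝ) < m := Nat.cast_pos.2 hm
  have hx1 := Nat.floor_le (mul_nonneg hm'.le x.2.1)
  have hx2 := Nat.lt_floor_add_one ((m : ℝ) * x)
  have hy1 := Nat.floor_le (mul_nonneg hm'.le y.2.1)
  have hy2 := Nat.lt_floor_add_one ((m : ℝ) * y)
  unfold gridIndex at h
  rw [h] at hx1 hx2
  rw [Subtype.dist_eq, Real.dist_eq, lt_div_iff₀' hm',
    show (m : ℝ) * |(x : ℝ) - y| = |m * ((x : ℝ) - y)| by rw [abs_mul, abs_of_pos hm'], abs_lt]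
  constructor <;> nlinarith

lemma gridIndex_le_succ {m : ℕ} (hm : 0 < m) {x y : I} (h : dist x y < 1 / m) :
    gridIndex m x ≤ gridIndex m y + 1 := by
  have hm' : (0 : ℝ) < m := Nat.cast_pos.2 hm
  rw [Subtype.dist_eq, Real.dist_eq, lt_div_iff₀' hm'] at h
  unfold gridIndex
  rw [← Nat.floor_add_one (mul_nonneg hm'.le y.2.1)]
  refine Nat.floor_mono ?_
  nlinarith [le_abs_self ((x : ℝ) - y)]

/-- One entourage serves both comparisons: cells have diameter below `1 / m`, and `1 / m`-close
points lie in equal or adjacent cells. The 6 is 3 for adjacency times 2 from `n + 1 ≤ 2 ^ n`. -/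
lemma IsFlattening.coverMincard_le {g f : I → I} (h : IsFlattening g f) (hg : Continuous g)
    (hf : Continuous f) {m : ℕ} (hm : 0 < m) (n : ℕ) :
    coverMincard g univ {p | dist p.1 p.2 < 1 / m} n ≤
      6 ^ n * coverMincard f univ {p | dist p.1 p.2 < 1 / m} n := by
  have hV : {p : I × I | dist p.1 p.2 < 1 / (m : ℝ)} ∈ 𝓤 I :=
    Metric.dist_mem_uniformity (by positivity)
  have htop := coverMincard_finite_of_isCompact_uniformContinuous isCompact_univ
    (CompactSpace.uniformContinuous_of_continuous hf) hV n
  obtain ⟨hfin, hle⟩ := ncard_range_itinerary_le_coverMincard (q := gridIndex m)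
    (fun x y hxy => ⟨gridIndex_le_succ hm hxy,
      gridIndex_le_succ hm (by rw [dist_comm]; exact hxy)⟩) htop
  obtain ⟨hfin', hle'⟩ := h.ncard_range_itinerary_le hg (gridIndex_monotone m)
    (gridIndex_locally_const_right hm) hfin
  refine (coverMincard_le_ncard_range_itinerary (q := gridIndex m)
    (fun x y hxy => dist_lt_of_gridIndex_eq hm hxy) hfin').trans ?_
  have h2 : n + 1 ≤ 2 ^ n := Nat.lt_two_pow_self
  calc ((range (itinerary g (gridIndex m) n)).ncard : ℕ∞)
      ≤ ((2 ^ n * (range (itinerary f (gridIndex m) n)).ncard : ℕ) : ℕ∞) := by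
        exact_mod_cast hle'.trans (Nat.mul_le_mul_right _ h2)
    _ = 2 ^ n * ((range (itinerary f (gridIndex m) n)).ncard : ℕ∞) := by push_cast; rfl
    _ ≤ 2 ^ n * (3 ^ n * coverMincard f univ {p | dist p.1 p.2 < 1 / m} n) := by gcongr
    _ = 6 ^ n * coverMincard f univ {p | dist p.1 p.2 < 1 / m} n := by
        rw [← mul_assoc, ← mul_pow]; norm_num

lemma IsFlattening.coverEntropy_le_add {g f : I → I} (h : IsFlattening g f) (hg : Continuous g)
    (hf : Continuous f) :
    coverEntropy g univ ≤ ENNReal.log 6 + coverEntropy f univ := by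
  refine iSup₂_le fun U hU => ?_
  obtain ⟨ε, hε, hεU⟩ := Metric.mem_uniformity_dist.1 hU
  obtain ⟨m, hm⟩ := exists_nat_one_div_lt hε
  set V : SetRel I I := {p | dist p.1 p.2 < 1 / ((m + 1 : ℕ) : ℝ)} with hVdef
  have hV : V ∈ 𝓤 I := Metric.dist_mem_uniformity (by positivity)
  have hVU : V ⊆ U := fun p hp => hεU (lt_trans hp (by exact_mod_cast hm))
  have hlog : ENNReal.log 6 ≠ ⊥ ∧ ENNReal.log 6 ≠ ⊤ := by
    simp [ENNReal.log_eq_bot_iff, ENNReal.log_eq_top_iff]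
  calc coverEntropyEntourage g univ U ≤ coverEntropyEntourage g univ V :=
        coverEntropyEntourage_antitone g univ hVU
    _ ≤ expGrowthSup ((fun n => (6 : ℝ≥0∞) ^ n) * fun n => (coverMincard f univ V n : ℝ≥0∞)) := by
        refine expGrowthSup_monotone fun n => ?_
        refine (ENat.toENNReal_mono (h.coverMincard_le hg hf m.succ_pos n)).trans ?_
        simp [hVdef]
    _ ≤ expGrowthSup (fun n => (6 : ℝ≥0∞) ^ n) + coverEntropyEntourage f univ V := by
        refine expGrowthSup_mul_le ?_ ?_ <;> rw [expGrowthSup_pow]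
        · exact Or.inl hlog.1
        · exact Or.inl hlog.2
    _ ≤ ENNReal.log 6 + coverEntropy f univ := by
        rw [expGrowthSup_pow]
        gcongr
        exact coverEntropyEntourage_le_coverEntropy f univ hV

/-! ### Entropy of iterates, and removal of the constant -/

lemma coverMincard_iterate_le (T : I → I) (U : SetRel I I) {N : ℕ} (hN : N ≠ 0) (n : ℕ) :
    coverMincard T^[N] univ U n ≤ coverMincard T univ U (N * n) := by
  refine biInf_mono fun s hs => SetRel.IsCover.mono_entourage (fun p hp => ?_) hs
  refine mem_dynEntourage.2 fun k hk => ?_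
  rw [← iterate_mul]
  exact mem_dynEntourage.1 hp _ (Nat.mul_lt_mul_of_pos_left hk (Nat.pos_of_ne_zero hN))

lemma expGrowthSup_coverMincard_mul (T : I → I) (U : SetRel I I) {N : ℕ} (hN : N ≠ 0) :
    expGrowthSup (fun n => (coverMincard T univ U (N * n) : ℝ≥0∞)) =
      N * coverEntropyEntourage T univ U :=
  Monotone.expGrowthSup_comp_mul (u := fun n => (coverMincard T univ U n : ℝ≥0∞))
    (ENat.toENNReal_mono.comp (coverMincard_monotone_time T univ U)) hN

lemma coverEntropy_iterate_le {T : I → I} {N : ℕ} (hN : N ≠ 0) :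
    coverEntropy T^[N] univ ≤ N * coverEntropy T univ := by
  refine iSup₂_le fun U hU => ?_
  refine (expGrowthSup_monotone fun n =>
    ENat.toENNReal_mono (coverMincard_iterate_le T U hN n)).trans ?_
  rw [expGrowthSup_coverMincard_mul T U hN]
  have hN' : (0 : EReal) ≤ N := by exact_mod_cast N.zero_le
  exact mul_le_mul_of_nonneg_left (coverEntropyEntourage_le_coverEntropy T univ hU) hN'

lemma le_coverEntropy_iterate {T : I → I} (hT : Continuous T) {N : ℕ} (hN : N ≠ 0) :
    N * coverEntropy T univ ≤ coverEntropy T^[N] univ := by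
  have hN' : (0 : EReal) < N := by exact_mod_cast Nat.pos_of_ne_zero hN
  rw [mul_comm, ← EReal.le_div_iff_mul_le hN' (EReal.natCast_ne_top N)]
  refine iSup₂_le fun U hU => ?_
  rw [EReal.le_div_iff_mul_le hN' (EReal.natCast_ne_top N), mul_comm]
  -- For `T^[N]`, `n` steps within this entourage control all `N * n` times of `T`, by writing `k =
  -- k % N + N * (k / N)`.
  have hV := dynEntourage_mem_uniformity (CompactSpace.uniformContinuous_of_continuous hT) hU N
  calc N * coverEntropyEntourage T univ U
      = expGrowthSup (fun n => (coverMincard T univ U (N * n) : ℝ≥0∞)) :=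
        (expGrowthSup_coverMincard_mul T U hN).symm
    _ ≤ coverEntropyEntourage T^[N] univ (dynEntourage T U N) := by
        refine expGrowthSup_monotone fun n => ENat.toENNReal_mono ?_
        refine biInf_mono fun s hs => SetRel.IsCover.mono_entourage (fun p hp => ?_) hs
        refine mem_dynEntourage.2 fun k hk => ?_
        have h1 := mem_dynEntourage.1 hp (k / N) (Nat.div_lt_of_lt_mul hk)
        have h2 := mem_dynEntourage.1 h1 (k % N) (Nat.mod_lt _ (Nat.pos_of_ne_zero hN))
        rwa [← iterate_mul, ← iterate_add_apply, ← iterate_add_apply, Nat.mod_add_div] at h2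
    _ ≤ coverEntropy T^[N] univ := coverEntropyEntourage_le_coverEntropy _ _ hV

/-- Flattening does not increase topological entropy. -/
theorem IsFlattening.coverEntropy_le {g f : I → I} (h : IsFlattening g f) (hg : Continuous g)
    (hf : Continuous f) : coverEntropy g univ ≤ coverEntropy f univ := by
  have key : ∀ N : ℕ, N ≠ 0 →
      N * coverEntropy g univ ≤ ENNReal.log 6 + N * coverEntropy f univ := fun N hN =>
    (le_coverEntropy_iterate hg hN).trans
      (((h.iterate hg N).coverEntropy_le_add (hg.iterate N) (hf.iterate N)).trans
        (add_le_add le_rfl (coverEntropy_iterate_le hN)))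
  have hg0 : 0 ≤ coverEntropy g univ := coverEntropy_nonneg _ univ_nonempty
  have hf0 : 0 ≤ coverEntropy f univ := coverEntropy_nonneg _ univ_nonempty
  have hlog : ENNReal.log 6 ≠ ⊥ ∧ ENNReal.log 6 ≠ ⊤ := by
    simp [ENNReal.log_eq_bot_iff, ENNReal.log_eq_top_iff]
  generalize ENNReal.log 6 = L at *
  generalize coverEntropy g univ = A at *
  generalize coverEntropy f univ = B at *
  by_contra hlt
  push Not at hlt
  lift L to ℝ using ⟨hlog.2, hlog.1⟩
  lift B to ℝ using ⟨ne_top_of_lt hlt, fun h => by simp [h] at hf0⟩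
  obtain ⟨r, hr1, hr2⟩ := EReal.lt_iff_exists_real_btwn.1 hlt
  rw [EReal.coe_lt_coe_iff] at hr1
  -- With `r` strictly between the two entropies, this `N` makes `N * (r - B)` exceed `log 6`.
  obtain ⟨N, hN⟩ := exists_nat_gt (L / (r - B))
  rw [div_lt_iff₀ (by linarith)] at hN
  have h1 : ((N + 1 : ℕ) : EReal) * (r : EReal) ≤ L + (N + 1 : ℕ) * (B : EReal) :=
    (mul_le_mul_of_nonneg_left hr2.le (by exact_mod_cast (N + 1).zero_le)).trans
      (key (N + 1) N.succ_ne_zero)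
  have h2 : ((N + 1 : ℕ) : ℝ) * r ≤ L + (N + 1 : ℕ) * B := by exact_mod_cast h1
  push_cast at h2
  nlinarith

/-- All orbits agree from time 1 on, so a cover for one step works for every `n`. -/
lemma coverEntropy_const_le (c : I) : coverEntropy (fun _ : I => c) univ ≤ 0 := by
  refine iSup₂_le fun U hU => ?_
  have hfin := coverMincard_finite_of_isCompact_uniformContinuous isCompact_univ
    (uniformContinuous_const (b := c)) hU 1
  have hpos := (one_le_coverMincard_iff (fun _ : I => c) univ U 1).2 univ_nonempty
  set K := coverMincard (fun _ : I => c) univ U 1 with hK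
  calc coverEntropyEntourage (fun _ : I => c) univ U ≤ expGrowthSup (fun _ => (K : ℝ≥0∞)) := by
        refine expGrowthSup_monotone fun n => ENat.toENNReal_mono ?_
        refine biInf_mono fun s hs => SetRel.IsCover.mono_entourage (fun p hp => ?_) hs
        refine mem_dynEntourage.2 fun k hk => ?_
        rcases k with _ | k
        · exact mem_dynEntourage.1 hp 0 one_pos
        · rw [iterate_succ_apply', iterate_succ_apply']
          exact refl_mem_uniformity hU
    _ = 0 := expGrowthSup_const (by simpa using (zero_lt_one.trans_le hpos).ne')
        (by simpa using hfin.ne)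

end IntervalMaps

/-! ### Two flattenings: truncation and trimming of peaks -/

namespace IntervalMaps

open Set Function Dynamics

/-- If `g x` is missed by `f '' J`, then `g x ≤ f x` and the intermediate value theorem put `f`
above `g x` on all of `J`, where `hconst` makes `g` constant. -/
lemma isFlattening_of_le {g f : I → I} (hf : Continuous f) (hle : ∀ x, g x ≤ f x)
    (hconst : ∀ x x', (∀ z ∈ uIcc x x', g x < f z) → g x' = g x) : IsFlattening g f := by
  intro J hJ
  rw [or_iff_not_imp_left, not_subset]
  rintro ⟨_, ⟨x, hx, rfl⟩, hgx⟩
  have hlt : ∀ z ∈ J, g x < f z := by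
    intro z hz
    by_contra hzx
    push Not at hzx
    obtain ⟨w, hw, hwx⟩ := (ordConnected_image hf hJ).out
      (mem_image_of_mem f hz) (mem_image_of_mem f hx) ⟨hzx, hle x⟩
    exact hgx ⟨w, hw, hwx⟩
  have h1 : ∀ x' ∈ J, g x' = g x := fun x' hx' =>
    hconst x x' fun z hz => hlt z (hJ.uIcc_subset hx hx' hz)
  rintro _ ⟨y, hy, rfl⟩ _ ⟨y', hy', rfl⟩
  rw [h1 y hy, h1 y' hy']

lemma isFlattening_inf_const {f : I → I} (hf : Continuous f) (c : I) :
    IsFlattening (fun x => f x ⊓ c) f := by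
  refine isFlattening_of_le hf (fun x => inf_le_left) fun x x' h => ?_
  have hx : c < f x := not_le.1 (inf_lt_left.1 (h x left_mem_uIcc))
  have hx' := h x' right_mem_uIcc
  simp only [inf_eq_right.2 hx.le] at hx' ⊢
  exact inf_eq_right.2 hx'.le

/-- The levels `c` such that `f ≥ c` on some interval from `x` to a point where `f` is at least
`c + t`, together with the levels `c ≤ 0`. -/
def trimSet (f : I → I) (t : ℝ) (x : I) : Set ℝ :=
  {c | ∃ y, (∀ z ∈ uIcc x y, c ≤ f z) ∧ c ≤ max ((f y : ℝ) - t) 0}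

/-- The function obtained from `f` by cutting its peaks at depth `t`. -/
noncomputable def trim (f : I → I) (t : ℝ) (x : I) : ℝ := sSup (trimSet f t x)

section trim

variable {f : I → I} {t c : ℝ} {x x' : I}

lemma zero_mem_trimSet : (0 : ℝ) ∈ trimSet f t x :=
  ⟨x, fun z _ => (f z).2.1, le_max_right _ _⟩

lemma le_of_mem_trimSet (h : c ∈ trimSet f t x) : c ≤ f x := by
  obtain ⟨y, hy, -⟩ := h
  exact hy x left_mem_uIcc

lemma bddAbove_trimSet : BddAbove (trimSet f t x) := ⟨f x, fun _ h => le_of_mem_trimSet h⟩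

lemma le_trim (h : c ∈ trimSet f t x) : c ≤ trim f t x := le_csSup bddAbove_trimSet h

lemma trim_le (h : ∀ b ∈ trimSet f t x, b ≤ c) : trim f t x ≤ c :=
  csSup_le ⟨0, zero_mem_trimSet⟩ h

lemma trim_nonneg : 0 ≤ trim f t x := le_trim zero_mem_trimSet

lemma trim_le_self : trim f t x ≤ f x := trim_le fun _ h => le_of_mem_trimSet h

lemma mem_trimSet_of_le {b : ℝ} (hbc : b ≤ c) (h : c ∈ trimSet f t x) : b ∈ trimSet f t x := by
  obtain ⟨y, hy, hy'⟩ := h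
  exact ⟨y, fun z hz => hbc.trans (hy z hz), hbc.trans hy'⟩

lemma mem_trimSet_transfer (h : c ∈ trimSet f t x) (hxx' : ∀ z ∈ uIcc x x', c ≤ f z) :
    c ∈ trimSet f t x' := by
  obtain ⟨y, hy, hy'⟩ := h
  refine ⟨y, fun z hz => ?_, hy'⟩
  rcases uIcc_subset_uIcc_union_uIcc hz with h | h
  · exact hxx' z (by rwa [uIcc_comm])
  · exact hy z h

/-- A level path from `x` extends to `x'` as long as `f` stays above the level in between. -/
lemma min_trim_le (hxx' : ∀ z ∈ uIcc x x', c ≤ f z) : min (trim f t x) c ≤ trim f t x' := by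
  by_contra h
  push Not at h
  obtain ⟨b, hb, hlt⟩ := exists_lt_of_lt_csSup ⟨0, zero_mem_trimSet⟩ (h.trans_le (min_le_left _ _))
  have := le_trim (mem_trimSet_transfer (mem_trimSet_of_le (min_le_left b c) hb)
    fun z hz => (min_le_right b c).trans (hxx' z hz))
  exact absurd (lt_min hlt (h.trans_le (min_le_right _ _))) this.not_gt

lemma trim_zero : trim f 0 x = f x :=
  le_antisymm trim_le_self <| le_trim ⟨x, by simp, by simp⟩

/-- The same endpoint `y` witnesses the level lowered by `d + e`; this makes trimming jointly
Lipschitz in the map and the depth. -/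
lemma trim_le_trim_add {f' : I → I} {t' d e : ℝ} (hd : ∀ z, (f z : ℝ) ≤ f' z + d) (he : t' ≤ t + e)
    (hd0 : 0 ≤ d) (he0 : 0 ≤ e) : trim f t x ≤ trim f' t' x + (d + e) := by
  refine trim_le fun c hc => ?_
  obtain ⟨y, hy, hy'⟩ := hc
  rw [← sub_le_iff_le_add]
  refine le_trim ⟨y, fun z hz => ?_, ?_⟩
  · linarith [hy z hz, hd z]
  · rcases le_max_iff.1 hy' with h | h
    · exact le_max_of_le_left (by linarith [hd y])
    · exact le_max_of_le_right (by linarith)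

/-- The minimum of `f` on the segment exceeds `trim f t x`, so `min_trim_le` applied both ways loses
nothing. -/
lemma trim_eq_of_lt (hf : Continuous f) (h : ∀ z ∈ uIcc x x', trim f t x < f z) :
    trim f t x' = trim f t x := by
  obtain ⟨w, hw, hmin⟩ := isCompact_uIcc.exists_isMinOn (nonempty_uIcc (a := x) (b := x'))
    hf.continuousOn
  have h1 := min_trim_le (t := t) (x := x) (x' := x') (c := f w) fun z hz => hmin hz
  have h2 := min_trim_le (t := t) (x := x') (x' := x) (c := f w)
    fun z hz => hmin (show z ∈ uIcc x x' by rwa [uIcc_comm])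
  rw [min_eq_left (h w hw).le] at h1
  rcases min_le_iff.1 h2 with h3 | h3
  · exact le_antisymm h3 h1
  · exact absurd (h w hw) h3.not_gt

lemma continuous_trim (hf : Continuous f) (t : ℝ) : Continuous (trim f t) := by
  refine Metric.continuous_iff.2 fun x ε hε => ?_
  obtain ⟨δ, hδ, h⟩ := Metric.continuous_iff.1 hf x (ε / 3) (by positivity)
  refine ⟨δ, hδ, fun x' hx' => ?_⟩
  have hnear : ∀ z ∈ uIcc x x', |(f z : ℝ) - f x| < ε / 3 := by
    intro z hz
    refine h z (lt_of_le_of_lt ?_ hx')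
    have := abs_sub_left_of_mem_uIcc
      (show (z : ℝ) ∈ uIcc (x : ℝ) x' from by
        rcases mem_uIcc.1 hz with h | h
        · exact mem_uIcc.2 (Or.inl h)
        · exact mem_uIcc.2 (Or.inr h))
    exact this
  have hx1 := abs_lt.1 (hnear x' right_mem_uIcc)
  have hlow : ∀ z ∈ uIcc x x', (f x : ℝ) - ε / 3 ≤ f z := fun z hz => by
    linarith [(abs_lt.1 (hnear z hz)).1]
  have h1 := min_trim_le (t := t) (x := x) (x' := x') (c := f x - ε / 3)
    hlow
  have h2 := min_trim_le (t := t) (x := x') (x' := x) (c := f x - ε / 3)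
    fun z hz => hlow z (by rwa [uIcc_comm])
  have h3 : trim f t x ≤ f x := trim_le_self
  have h4 : trim f t x' ≤ f x' := trim_le_self
  rw [Real.dist_eq, abs_lt]
  rcases min_le_iff.1 h1 with h1 | h1 <;> rcases min_le_iff.1 h2 with h2 | h2 <;>
    constructor <;> linarith

/-- On an interval where `f` oscillates by less than `t`, cutting peaks at depth `t` leaves no
local maximum. -/
lemma trim_le_max {a b d : I} (hab : a ≤ b) (hbd : b ≤ d)
    (hosc : ∀ z ∈ Icc a d, ∀ w ∈ Icc a d, (f z : ℝ) < f w + t) :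
    trim f t b ≤ max (trim f t a) (trim f t d) := by
  by_contra h
  push Not at h
  obtain ⟨c, ⟨y, hy, hy'⟩, hlt⟩ := exists_lt_of_lt_csSup ⟨0, zero_mem_trimSet⟩ h
  obtain ⟨ha, hd⟩ := max_lt_iff.1 hlt
  have hc0 : 0 < c := trim_nonneg.trans_lt ha
  have hcy : c ≤ f y - t := (le_max_iff.1 hy').resolve_right hc0.not_ge
  -- A path from `b` to a `y` outside `[a, d]` passes through `a` or `d` at level `c`. If `y` is
  -- inside, small oscillation puts `f` above `f y - t ≥ c` on `[a, b]`.
  rcases lt_or_ge y a with hya | hya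
  · refine absurd (le_trim (mem_trimSet_transfer (x' := a) ⟨y, hy, hy'⟩ fun z hz => hy z ?_))
      ha.not_ge
    rw [uIcc_of_ge hab] at hz
    rw [uIcc_of_ge (hya.le.trans hab)]
    exact ⟨hya.le.trans hz.1, hz.2⟩
  rcases lt_or_ge d y with hdy | hdy
  · refine absurd (le_trim (mem_trimSet_transfer (x' := d) ⟨y, hy, hy'⟩ fun z hz => hy z ?_))
      hd.not_ge
    rw [uIcc_of_le hbd] at hz
    rw [uIcc_of_le (hbd.trans hdy.le)]
    exact ⟨hz.1, hz.2.trans hdy.le⟩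
  · refine absurd (le_trim (mem_trimSet_transfer (x' := a) ⟨y, hy, hy'⟩ fun z hz => ?_)) ha.not_ge
    rw [uIcc_of_ge hab] at hz
    linarith [hosc y ⟨hya, hdy⟩ z ⟨hz.1, hz.2.trans hbd⟩]

end trim

/-- The continuous self-map obtained from `f` by cutting its peaks at depth `t`. -/
noncomputable def trimMap (f : C(I, I)) (t : ℝ) : C(I, I) where
  toFun x := ⟨trim f t x, trim_nonneg, trim_le_self.trans (f x).2.2⟩
  continuous_toFun := (continuous_trim f.continuous t).subtype_mk _

lemma isFlattening_trimMap (f : C(I, I)) (t : ℝ) : IsFlattening (trimMap f t) f :=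
  isFlattening_of_le f.continuous (fun _ => trim_le_self) fun _ _ h =>
    Subtype.ext (trim_eq_of_lt f.continuous h)

lemma trimMap_zero (f : C(I, I)) : trimMap f 0 = f :=
  ContinuousMap.ext fun _ => Subtype.ext trim_zero

lemma dist_trimMap_le (f f' : C(I, I)) (t t' : ℝ) :
    dist (trimMap f t) (trimMap f' t') ≤ dist f f' + dist t t' := by
  rw [ContinuousMap.dist_le (by positivity)]
  intro x
  have hd : ∀ z, |(f z : ℝ) - f' z| ≤ dist f f' := fun z =>
    ContinuousMap.dist_apply_le_dist (f := f) (g := f') z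
  have ht : |t - t'| ≤ dist t t' := le_rfl
  rw [Subtype.dist_eq, Real.dist_eq, abs_sub_le_iff]
  constructor
  · rw [sub_le_iff_le_add']
    exact trim_le_trim_add (fun z => by linarith [(abs_le.1 (hd z)).2])
      (by linarith [(abs_le.1 ht).1]) dist_nonneg dist_nonneg
  · rw [sub_le_iff_le_add']
    exact trim_le_trim_add (fun z => by linarith [(abs_le.1 (hd z)).1])
      (by linarith [(abs_le.1 ht).2]) dist_nonneg dist_nonneg

lemma continuous_trimMap : Continuous fun p : C(I, I) × ℝ => trimMap p.1 p.2 := by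
  refine Metric.continuous_iff.2 fun p ε hε => ⟨ε / 2, half_pos hε, fun p' hp' => ?_⟩
  rw [Prod.dist_eq, max_lt_iff] at hp'
  linarith [dist_trimMap_le p'.1 p.1 p'.2 p.2]

/-! ### Piecewise monotonicity of trimmed maps -/

/-- `f` is piecewise monotone on `[0, b]`. -/
def IsPiecewiseMonotoneUpTo (f : I → I) (b : I) : Prop :=
  ∃ (n : ℕ) (t : Fin (n + 1) → I), StrictMono t ∧ t 0 = 0 ∧ t (Fin.last n) = b ∧
    ∀ i : Fin n, MonotoneOn f (Icc (t i.castSucc) (t i.succ)) ∨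
      AntitoneOn f (Icc (t i.castSucc) (t i.succ))

lemma isPiecewiseMonotoneUpTo_zero (f : I → I) : IsPiecewiseMonotoneUpTo f 0 :=
  ⟨0, fun _ => 0, fun i j h => by omega, rfl, rfl, fun i => i.elim0⟩

lemma IsPiecewiseMonotoneUpTo.extend {f : I → I} {b c : I} (h : IsPiecewiseMonotoneUpTo f b)
    (hbc : b ≤ c) (hf : MonotoneOn f (Icc b c) ∨ AntitoneOn f (Icc b c)) :
    IsPiecewiseMonotoneUpTo f c := by
  rcases hbc.eq_or_lt with rfl | hlt
  · exact h
  obtain ⟨n, t, ht, h0, hn, hmono⟩ := h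
  refine ⟨n + 1, Fin.snoc t c, ?_, ?_, by simp, ?_⟩
  · rw [Fin.strictMono_iff_lt_succ]
    intro i
    induction i using Fin.lastCases with
    | last => simpa [hn] using hlt
    | cast i =>
      rw [Fin.succ_castSucc, Fin.snoc_castSucc, Fin.snoc_castSucc]
      exact ht i.castSucc_lt_succ
  · rw [← Fin.castSucc_zero, Fin.snoc_castSucc, h0]
  · intro i
    induction i using Fin.lastCases with
    | last => simpa [hn] using hf
    | cast i =>
      rw [Fin.succ_castSucc, Fin.snoc_castSucc, Fin.snoc_castSucc]
      exact hmono i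

/-- Without interior peaks, `f` decreases up to a minimum point and increases after it. -/
lemma IsPiecewiseMonotoneUpTo.extend_of_le_max {f : I → I} (hf : Continuous f) {b c : I}
    (h : IsPiecewiseMonotoneUpTo f b) (hbc : b ≤ c)
    (hmax : ∀ x ∈ Icc b c, ∀ y ∈ Icc b c, ∀ z, x ≤ z → z ≤ y → f z ≤ max (f x) (f y)) :
    IsPiecewiseMonotoneUpTo f c := by
  obtain ⟨m, hm, hmin⟩ := isCompact_Icc.exists_isMinOn (nonempty_Icc.2 hbc) hf.continuousOn
  refine (h.extend hm.1 (Or.inr ?_)).extend hm.2 (Or.inl ?_)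
  · intro x hx y hy hxy
    have hx' : x ∈ Icc b c := ⟨hx.1, hx.2.trans hm.2⟩
    exact (hmax x hx' m hm y hxy hy.2).trans (max_le le_rfl (hmin hx'))
  · intro x hx y hy hxy
    have hy' : y ∈ Icc b c := ⟨hm.1.trans hy.1, hy.2⟩
    exact (hmax m hm y hy' x hx.1 hxy).trans (max_le (hmin hy') le_rfl)

lemma isPiecewiseMonotone_trimMap (f : C(I, I)) {t : ℝ} (ht : 0 < t) :
    IsPiecewiseMonotone (trimMap f t) := by
  obtain ⟨δ, hδ, h⟩ := Metric.uniformContinuous_iff.1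
    (CompactSpace.uniformContinuous_of_continuous f.continuous) t ht
  obtain ⟨N, hN⟩ := exists_nat_one_div_lt hδ
  -- The grid step is below the modulus `δ` for oscillation `t`, so `trim_le_max` applies on each
  -- grid interval.
  have hstep : ∀ k : ℕ, IsPiecewiseMonotoneUpTo (trimMap f t)
      (projIcc (0 : ℝ) 1 zero_le_one (k / (N + 1))) := by
    intro k
    induction k with
    | zero =>
      rw [Nat.cast_zero, zero_div, projIcc_left]
      exact isPiecewiseMonotoneUpTo_zero _
    | succ k ih =>
      have hle : (k : ℝ) / (N + 1) ≤ ((k + 1 : ℕ) : ℝ) / (N + 1) := by gcongr; simp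
      refine ih.extend_of_le_max (trimMap f t).continuous (monotone_projIcc _ hle) ?_
      intro x hx y hy z hxz hzy
      refine trim_le_max hxz hzy fun u hu v hv => ?_
      have hlen : (projIcc (0 : ℝ) 1 zero_le_one (((k + 1 : ℕ) : ℝ) / (N + 1)) : ℝ) -
          projIcc (0 : ℝ) 1 zero_le_one ((k : ℝ) / (N + 1)) < δ := by
        have h1 := abs_projIcc_sub_projIcc (a := (0 : ℝ)) (b := 1) (h := zero_le_one)
          (c := ((k + 1 : ℕ) : ℝ) / (N + 1)) (d := (k : ℝ) / (N + 1))
        have h2 : ((k + 1 : ℕ) : ℝ) / (N + 1) - (k : ℝ) / (N + 1) = 1 / (N + 1) := by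
          push_cast; ring
        rw [h2, abs_of_pos (by positivity : (0 : ℝ) < 1 / (N + 1))] at h1
        linarith [le_abs_self ((projIcc (0 : ℝ) 1 zero_le_one (((k + 1 : ℕ) : ℝ) / (N + 1)) : ℝ) -
          projIcc (0 : ℝ) 1 zero_le_one ((k : ℝ) / (N + 1)))]
      have hu1 : (_ : ℝ) ≤ u := hx.1.trans hu.1
      have hu2 : (u : ℝ) ≤ _ := hu.2.trans hy.2
      have hv1 : (_ : ℝ) ≤ v := hx.1.trans hv.1
      have hv2 : (v : ℝ) ≤ _ := hv.2.trans hy.2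
      have huv : dist u v < δ := by
        rw [Subtype.dist_eq, Real.dist_eq, abs_lt]
        constructor <;> linarith
      have := h huv
      rw [Subtype.dist_eq, Real.dist_eq, abs_lt] at this
      linarith [this.2]
  have h1 := hstep (N + 1)
  rw [Nat.cast_succ, div_self (by positivity), projIcc_right] at h1
  exact h1

/-! ### The homotopies -/

lemma topEntropy_le_of_isFlattening {g f : C(I, I)} (h : IsFlattening g f) :
    topEntropy g ≤ topEntropy f :=
  h.coverEntropy_le g.continuous f.continuous

lemma topEntropy_const_le (c : I) : topEntropy (ContinuousMap.const I c) ≤ 0 :=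
  coverEntropy_const_le c

/-- The truncation of `f` from above at the level `c`. -/
def truncate (f : C(I, I)) (c : I) : C(I, I) := f ⊓ ContinuousMap.const I c

lemma continuous_truncate : Continuous fun p : C(I, I) × I => truncate p.1 p.2 :=
  ContinuousMap.continuous_of_continuous_uncurry _ <|
    ((continuous_fst.comp continuous_fst).eval continuous_snd).inf
      (continuous_snd.comp continuous_fst)

/-- A set of maps containing all flattenings of its members, and a constant map, contracts. -/
lemma contractibleSpace_of_isFlattening {E : Set C(I, I)}
    (hE : ∀ f ∈ E, ∀ g : C(I, I), IsFlattening g f → g ∈ E)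
    (h0 : ContinuousMap.const I 0 ∈ E) : ContractibleSpace E := by
  rw [contractible_iff_id_nullhomotopic]
  -- The truncation level `σ p.1` falls from 1, which changes nothing, to 0.
  refine ⟨⟨_, h0⟩, ⟨⟨⟨fun p => ⟨truncate p.2 (σ p.1),
    hE _ p.2.2 _ (isFlattening_inf_const (p.2 : C(I, I)).continuous _)⟩, ?_⟩, ?_, ?_⟩⟩⟩
  · refine Continuous.subtype_mk (continuous_truncate.comp
      (f := fun p : I × E => ((p.2 : C(I, I)), σ p.1)) ?_) _
    exact (continuous_subtype_val.comp continuous_snd).prodMk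
      (unitInterval.continuous_symm.comp continuous_fst)
  · intro f
    refine Subtype.ext (ContinuousMap.ext fun x => ?_)
    simpa [truncate] using unitInterval.le_one'
  · intro f
    refine Subtype.ext (ContinuousMap.ext fun x => ?_)
    simp [truncate]

/-- The homotopy time is the trimming depth. -/
lemma isHomotopyDense_of_isFlattening {E : Set C(I, I)}
    (hE : ∀ f ∈ E, ∀ g : C(I, I), IsFlattening g f → g ∈ E) :
    IsHomotopyDense (Subtype.val ⁻¹' (E ∩ {f | IsPiecewiseMonotone f}) : Set E) := by
  refine ⟨⟨fun p => ⟨trimMap p.1 p.2, hE _ p.1.2 _ (isFlattening_trimMap _ _)⟩, ?_⟩, ?_, ?_⟩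
  · refine Continuous.subtype_mk (continuous_trimMap.comp
      (f := fun p : E × I => ((p.1 : C(I, I)), (p.2 : ℝ))) ?_) _
    exact (continuous_subtype_val.comp continuous_fst).prodMk
      (continuous_subtype_val.comp continuous_snd)
  · exact fun f => Subtype.ext (trimMap_zero f)
  · exact fun f t ht => ⟨hE _ f.2 _ (isFlattening_trimMap _ _), isPiecewiseMonotone_trimMap _ ht⟩

end IntervalMaps

theorem mainTheorem3 (a : ℝ≥0∞) :
    ContractibleSpace (IntervalMaps.entropyLE a) ∧
    (0 < a → ContractibleSpace (IntervalMaps.entropyLT a)) ∧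
    IntervalMaps.IsHomotopyDense
      (Subtype.val ⁻¹' IntervalMaps.entropyLEPM a : Set (IntervalMaps.entropyLE a)) ∧
    IntervalMaps.IsHomotopyDense
      (Subtype.val ⁻¹' IntervalMaps.entropyLTPM a : Set (IntervalMaps.entropyLT a)) := by
  have hLE : ∀ f ∈ IntervalMaps.entropyLE a, ∀ g : C(I, I), IntervalMaps.IsFlattening g f →
      g ∈ IntervalMaps.entropyLE a := fun f hf g hg =>
    (IntervalMaps.topEntropy_le_of_isFlattening hg).trans hf
  have hLT : ∀ f ∈ IntervalMaps.entropyLT a, ∀ g : C(I, I), IntervalMaps.IsFlattening g f →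
      g ∈ IntervalMaps.entropyLT a := fun f hf g hg =>
    (IntervalMaps.topEntropy_le_of_isFlattening hg).trans_lt hf
  exact ⟨IntervalMaps.contractibleSpace_of_isFlattening hLE
      ((IntervalMaps.topEntropy_const_le 0).trans (EReal.coe_ennreal_nonneg a)),
    fun ha => IntervalMaps.contractibleSpace_of_isFlattening hLT
      ((IntervalMaps.topEntropy_const_le 0).trans_lt (EReal.coe_ennreal_pos.2 ha)),
    IntervalMaps.isHomotopyDense_of_isFlattening hLE,
    IntervalMaps.isHomotopyDense_of_isFlattening hLT⟩
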